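/- Let $\omega=e^{2\pi i/3}$ and identify $\mathbb R^2$ with $\mathbb C$. Fix $p\in[0,1]$. The elephant random walk on the triangular lattice is defined as follows. The first step $X_1$ is uniform on $\{\pm1,\pm\omega,\pm\omega^2\}$. For each $n\ge1$, let $T_n$ be uniform on $\{1,\dots,n\}$, let $\xi_{n+1}$ be uniform on $\{\pm1,\pm\omega,\pm\omega^2\}$, and put $$X_{n+1}=\begin{cases}X_{T_n}&\text{with probability }p/2,\\-X_{T_n}&\text{with probability }p/2,\\ \xi_{n+1}&\text{with probability }1-p,\end{cases}$$ where $X_1$, all the $T_n$, all the $\xi_{n+1}$ and all the choices among the three cases are mutually independent. Let $S_n=\sum_{i=1}^nX_i$ (with $S_0=0$). Then: 1. For every $p\in[0,1]$, $S_n/n\to0$ almost surely as $n\to\infty$. 2. There is a non-degenerate Gaussian law $\nu$ on the plane, not depending on $p$, such that for every $p\in[0,1)$, $S_n/\sqrt n$ converges in distribution to $\nu$ as $n\to\infty$. -/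

import Mathlib

open MeasureTheory ProbabilityTheory Filter Topology

namespace ElephantWalk

/-- The primitive cube root of unity `ω = exp (2πi / 3)`. -/
noncomputable def ω : ℂ := Complex.exp (2 * Real.pi * Complex.I / 3)

/-- The six unit steps `±1, ±ω, ±ω²` of the triangular lattice (in the plane `ℂ = ℝ²`). -/
noncomputable def steps : Set ℂ := {1, -1, ω, -ω, ω ^ 2, -ω ^ 2}

/-- What the walker does at a given time: repeat the recalled step, repeat its negation, or take
a fresh step. -/
inductive Move
  | keep
  | negate
  | fresh

instance : MeasurableSpace Move := ⊤

/-- The sources of randomness of the walk. The walker's steps are numbered `X 0, X 1, X 2, …`;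
for every `n : ℕ`, the sources `pick n`, `move n` and `fresh n` are used to build the step
`X (n + 1)`, when the `n + 1` steps `X 0, …, X n` are already known. -/
inductive Source
  | first
  | pick (n : ℕ)
  | move (n : ℕ)
  | fresh (n : ℕ)

/-- The values taken by each source: a step, the index of one of the `n + 1` past steps,
a kind of move, a step. -/
def Source.Val : Source → Type
  | .first => ℂ
  | .pick n => Fin (n + 1)
  | .move _ => Move
  | .fresh _ => ℂ

instance : (s : Source) → MeasurableSpace s.Val
  | .first => inferInstanceAs (MeasurableSpace ℂ)
  | .pick n => inferInstanceAs (MeasurableSpace (Fin (n + 1)))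
  | .move _ => inferInstanceAs (MeasurableSpace Move)
  | .fresh _ => inferInstanceAs (MeasurableSpace ℂ)

/-- The law of the kind of move: `keep` with probability `p / 2`, `negate` with probability `p / 2`,
`fresh` with probability `1 - p` (a probability measure when `0 ≤ p ≤ 1`). -/
noncomputable def moveLaw (p : ℝ) : Measure Move :=
  ENNReal.ofReal (p / 2) • Measure.dirac Move.keep
    + ENNReal.ofReal (p / 2) • Measure.dirac Move.negate
    + ENNReal.ofReal (1 - p) • Measure.dirac Move.fresh

/-- The law of each source. -/
noncomputable def Source.law (p : ℝ) : (s : Source) → Measure s.Val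
  | .first => (uniformOn steps : Measure ℂ)
  | .pick n => (uniformOn Set.univ : Measure (Fin (n + 1)))
  | .move _ => moveLaw p
  | .fresh _ => (uniformOn steps : Measure ℂ)

/-- `N` is a family of mutually independent random variables on `(Ω, μ)`, one for each source,
with the prescribed laws. -/
structure IsNoise {Ω : Type*} [MeasurableSpace Ω] (p : ℝ) (N : (s : Source) → Ω → s.Val)
    (μ : Measure Ω) : Prop where
  measurable : ∀ s, Measurable (N s)
  hasLaw : ∀ s, HasLaw (N s) (s.law p) μ
  indep : iIndepFun N μ

/-- The steps of the elephant random walk driven by `N`; `X N n` is the `(n + 1)`-st step. -/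
def X {Ω : Type*} (N : (s : Source) → Ω → s.Val) : ℕ → Ω → ℂ
  | 0, a => N .first a
  | n + 1, a =>
    let T : Fin (n + 1) := N (.pick n) a
    match (N (.move n) a : Move) with
    | .keep => X N T a
    | .negate => -X N T a
    | .fresh => N (.fresh n) a
  termination_by n => n
  decreasing_by all_goals exact T.isLt

/-- The position after `n` steps, `S 0 = 0`. -/
noncomputable def S {Ω : Type*} (N : (s : Source) → Ω → s.Val) (n : ℕ) (a : Ω) : ℂ :=
  ∑ i ∈ Finset.range n, X N i a

end ElephantWalk

/-! ### The six steps and averages over them. -/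

namespace ElephantWalk

/-! A recalled step is kept or negated with equal probability, so given the past only the even part
of a function of the next step feels the memory (`integral_mul_comp_X_succ`). An odd function has
conditional mean zero. A centred even `f` has conditional mean `p / n` times its sum over the `n`
past steps. Expanding squares, `integral_stepSum_sq_le` bounds the second moments of the sums by a
constant times `n` in the odd case and, for `p < 1`, by a constant times `n ^ (1 + p)` in the even
case.

Law of large numbers: the real and imaginary parts are odd, so their sums have second moments of
order `n`. This gives almost sure convergence along the squares, and bounded increments fill the
gaps.

Central limit theorem: for odd `θ` with `cos θ > 0` on the steps, the even part of `R = exp (iθ) /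
cos θ` is `1`, so products of `R` along the walk have mean `1` for every `p`. With `g = -log (cos
θ)`, `exp (i ∑ θ)` is the product of `R` times `exp (-∑ g)`. Since `g` is even, `∑ g` deviates from
`n * stepMean g` by at most the order of `n ^ ((1 + p) / 2)` times the size of `g` in mean square.
For `θ v = ⟪v, t⟫ / √n`, `g` has size `1 / n`, so for `p < 1` the deviation vanishes. The
characteristic function then tends to `exp (-‖t‖² / 4)`, where `p` no longer appears. -/

lemma ω_eq : ω = ⟨-1 / 2, √3 / 2⟩ := by
  have h : (2 * Real.pi * Complex.I / 3 : ℂ) = ((Real.pi - Real.pi / 3 : ℝ) : ℂ) * Complex.I := by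
    push_cast; ring
  rw [ω, h]
  apply Complex.ext
  · rw [Complex.exp_ofReal_mul_I_re, Real.cos_pi_sub, Real.cos_pi_div_three]; norm_num
  · rw [Complex.exp_ofReal_mul_I_im, Real.sin_pi_sub, Real.sin_pi_div_three]

lemma ω_sq_eq : ω ^ 2 = ⟨-1 / 2, -(√3 / 2)⟩ := by
  have h3 : √3 * √3 = 3 := Real.mul_self_sqrt (by norm_num)
  rw [ω_eq, sq]
  apply Complex.ext <;> simp only [Complex.mul_re, Complex.mul_im] <;> linarith

/-- The six steps, as a finset. -/
noncomputable def stepsFinset : Finset ℂ := {1, -1, ω, -ω, ω ^ 2, -ω ^ 2}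

lemma coe_stepsFinset : (stepsFinset : Set ℂ) = steps := by
  simp [stepsFinset, steps]

lemma mem_stepsFinset {v : ℂ} : v ∈ stepsFinset ↔ v ∈ steps := by
  rw [← coe_stepsFinset, Finset.mem_coe]

lemma finite_steps : steps.Finite := coe_stepsFinset ▸ stepsFinset.finite_toSet

lemma measurableSet_steps : MeasurableSet steps := finite_steps.measurableSet

lemma norm_eq_one_of_mem_steps {v : ℂ} (hv : v ∈ steps) : ‖v‖ = 1 := by
  have hω : ‖ω‖ = 1 := by
    have h : (2 * Real.pi * Complex.I / 3 : ℂ) = ((2 * Real.pi / 3 : ℝ) : ℂ) * Complex.I := by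
      push_cast; ring
    rw [ω, h, Complex.norm_exp_ofReal_mul_I]
  simp only [steps, Set.mem_insert_iff, Set.mem_singleton_iff] at hv
  rcases hv with rfl | rfl | rfl | rfl | rfl | rfl <;> simp [hω]

lemma neg_mem_steps {v : ℂ} (hv : v ∈ steps) : -v ∈ steps := by
  simp only [steps, Set.mem_insert_iff, Set.mem_singleton_iff] at hv ⊢
  rcases hv with rfl | rfl | rfl | rfl | rfl | rfl <;> simp

section StepMean

variable {𝕜 : Type*} [RCLike 𝕜]

lemma sum_stepsFinset {E : Type*} [AddCommMonoid E] (f : ℂ → E) :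
    ∑ v ∈ stepsFinset, f v = f 1 + (f (-1) + (f ω + (f (-ω) + (f (ω ^ 2) + f (-ω ^ 2))))) := by
  have h3 : 0 < √3 := Real.sqrt_pos.2 (by norm_num)
  unfold stepsFinset
  rw [Finset.sum_insert, Finset.sum_insert, Finset.sum_insert, Finset.sum_insert,
    Finset.sum_insert, Finset.sum_singleton]
  -- The six steps are distinct, as their coordinates show.
  all_goals
    simp only [Finset.mem_insert, Finset.mem_singleton, ω_sq_eq]
    simp only [ω_eq, Complex.ext_iff, Complex.neg_re, Complex.neg_im, Complex.one_re, Complex.one_im, not_or, not_and_or]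
    norm_num
    try grind

lemma card_stepsFinset : stepsFinset.card = 6 := by
  simp [Finset.card_eq_sum_ones, sum_stepsFinset fun _ => 1, -Finset.sum_const]

/-- The mean of a function over the six steps. -/
noncomputable def stepMean (f : ℂ → 𝕜) : 𝕜 := (∑ v ∈ stepsFinset, f v) / 6

/-- The six steps form three antipodal pairs. -/
lemma stepMean_of_add_neg {f : ℂ → 𝕜} {c : 𝕜} (h : ∀ v ∈ steps, f v + f (-v) = c) :
    stepMean f = c / 2 := by
  have h1 := h 1 (by simp [steps])
  have h2 := h ω (by simp [steps])
  have h3 := h (ω ^ 2) (by simp [steps])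
  rw [stepMean, sum_stepsFinset]
  linear_combination (h1 + h2 + h3) / 6

lemma integral_uniformOn_steps (f : ℂ → 𝕜) : ∫ v, f v ∂(uniformOn steps) = stepMean f := by
  have hfin : (Measure.count : Measure ℂ) stepsFinset = 6 := by
    rw [Measure.count_apply_finset, card_stepsFinset]; norm_num
  have hi : IntegrableOn f (stepsFinset : Set ℂ) Measure.count := by
    rw [← Set.biUnion_of_singleton (stepsFinset : Set ℂ)]
    exact integrableOn_finset_iUnion.2 fun x _ => integrableOn_singleton (by simp) (by simp)
  rw [uniformOn, ← coe_stepsFinset, ProbabilityTheory.cond, integral_smul_measure, setIntegral_finset _ hi, hfin,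
    stepMean, div_eq_inv_mul]
  simp only [ENNReal.toReal_inv, ENNReal.toReal_ofNat, Measure.real, Measure.count_singleton,
    ENNReal.toReal_one, one_smul, RCLike.real_smul_eq_coe_mul]
  norm_num [map_ofNat]

end StepMean

/-! ### The one-step recursion and its measurability. -/

section Step

variable {Ω : Type*} (N : (s : Source) → Ω → s.Val) (n : ℕ)

/-- The index of the step recalled at time `n + 1`. -/
def pick : Ω → Fin (n + 1) := N (.pick n)

/-- The kind of move made at time `n + 1`. -/
def move : Ω → Move := N (.move n)

/-- The fresh step available at time `n + 1`. -/
def fresh : Ω → ℂ := N (.fresh n)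

lemma X_zero (a : Ω) : X N 0 a = N .first a := by rw [X]

lemma X_succ_keep {a : Ω} (h : move N n a = .keep) : X N (n + 1) a = X N (pick N n a) a := by
  change N (.move n) a = _ at h
  rw [X, h]
  rfl

lemma X_succ_negate {a : Ω} (h : move N n a = .negate) :
    X N (n + 1) a = -X N (pick N n a) a := by
  change N (.move n) a = _ at h
  rw [X, h]
  rfl

lemma X_succ_fresh {a : Ω} (h : move N n a = .fresh) : X N (n + 1) a = fresh N n a := by
  change N (.move n) a = _ at h
  rw [X, h]
  rfl

/-- The event that the step `i` is recalled and the move `m` is made. -/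
def choice (i : Fin (n + 1)) (m : Move) : Set Ω := {a | pick N n a = i ∧ move N n a = m}

variable {𝕜 : Type*} [RCLike 𝕜]

/-- Each term of the sum is a function of a past step times a function of the sources new at this
time; independence can then factor its integral. -/
lemma comp_X_succ (f : ℂ → 𝕜) (a : Ω) :
    f (X N (n + 1) a) =
      (∑ i : Fin (n + 1), (f (X N i a) * (choice N n i .keep).indicator 1 a
        + f (-X N i a) * (choice N n i .negate).indicator 1 a))
      + {a | move N n a = .fresh}.indicator (fun a => f (fresh N n a)) a := by
  classical
  rcases h : move N n a with _ | _ | _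
  · simp [X_succ_keep N n h, choice, h, Set.indicator_apply]
  · simp [X_succ_negate N n h, choice, h, Set.indicator_apply]
  · simp [X_succ_fresh N n h, choice, h]

end Step

/-- The number of steps already known when the source is used. -/
def Source.time : Source → ℕ
  | .first => 0
  | .pick n => n + 1
  | .move n => n + 1
  | .fresh n => n + 1

instance : MeasurableSingletonClass Move := ⟨fun _ => trivial⟩

instance : Countable Move :=
  Function.Injective.countable (f := fun m : Move => (match m with
    | .keep => 0
    | .negate => 1
    | .fresh => 2 : ℕ)) (by rintro (_ | _ | _) (_ | _ | _) <;> simp)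

/-- The σ-algebra on `Ω` is arbitrary and only the early sources need be measurable, so that the
lemma applies to `past N n` itself. -/
lemma measurable_X_of_time_le {Ω : Type*} [MeasurableSpace Ω] {N : (s : Source) → Ω → s.Val}
    {n : ℕ} (hN : ∀ s, s.time ≤ n → Measurable (N s)) {k : ℕ} (hk : k ≤ n) :
    Measurable (X N k) := by
  induction k using Nat.strong_induction_on with
  | _ k ih =>
    rcases k with _ | k
    · rw [funext (X_zero N)]
      exact hN .first (Nat.zero_le _)
    · have hp : Measurable (pick N k) := hN (.pick k) hk
      have hm : Measurable (move N k) := hN (.move k) hk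
      have hf : Measurable (fresh N k) := hN (.fresh k) hk
      have hX (i : Fin (k + 1)) : Measurable (X N i) := ih i i.2 (by omega)
      rw [show X N (k + 1) = fun a => id (X N (k + 1) a) from rfl]
      simp_rw [comp_X_succ N k (id : ℂ → ℂ)]
      have hc (i : Fin (k + 1)) (m : Move) : MeasurableSet (choice N k i m) :=
        (hp (measurableSet_singleton i)).inter (hm (measurableSet_singleton m))
      refine .add (Finset.measurable_sum _ fun i _ => .add ?_ ?_) ?_
      · exact (hX i).mul (measurable_one.indicator (hc i _))
      · exact (hX i).neg.mul (measurable_one.indicator (hc i _))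
      · exact hf.indicator (hm (measurableSet_singleton _))

/-! ### Independence of the past and the next sources. -/

section Independence

variable {Ω : Type*} {N : (s : Source) → Ω → s.Val} {n : ℕ}

variable (N n)

/-- The information carried by the first `n + 1` steps. -/
@[reducible]
def past : MeasurableSpace Ω :=
  ⨆ s ∈ {s : Source | s.time ≤ n}, MeasurableSpace.comap (N s) inferInstance

/-- The information carried by the sources which are used for the step `X (n + 1)`. -/
@[reducible]
def next : MeasurableSpace Ω :=
  ⨆ s ∈ {s : Source | s.time = n + 1}, MeasurableSpace.comap (N s) inferInstance

variable {N n}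

lemma measurable_X_past {k : ℕ} (hk : k ≤ n) : Measurable[past N n] (X N k) :=
  @measurable_X_of_time_le Ω (past N n) N n
    (fun s hs => Measurable.mono (comap_measurable (N s)) (le_iSup₂_of_le s hs le_rfl) le_rfl) k hk

lemma measurable_next {s : Source} (hs : s.time = n + 1) : Measurable[next N n] (N s) :=
  Measurable.mono (comap_measurable (N s)) (le_iSup₂_of_le s hs le_rfl) le_rfl

namespace IsNoise

variable [mΩ : MeasurableSpace Ω] {p : ℝ} {μ : Measure Ω} {𝕜 : Type*} [RCLike 𝕜]
  (hN : IsNoise p N μ)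
include hN

lemma past_le : past N n ≤ mΩ := iSup₂_le fun s _ => (hN.measurable s).comap_le

lemma next_le : next N n ≤ mΩ := iSup₂_le fun s _ => (hN.measurable s).comap_le

lemma indep_past_next : Indep (past N n) (next N n) μ := by
  refine indep_iSup_of_disjoint (fun s => (hN.measurable s).comap_le) hN.indep.iIndep ?_
  rw [Set.disjoint_left]
  intro s h1 h2
  simp only [Set.mem_ofPred_eq] at h1 h2
  omega

lemma integral_mul {U V : Ω → 𝕜} (hU : Measurable[past N n] U) (hV : Measurable[next N n] V) :
    ∫ a, U a * V a ∂μ = (∫ a, U a ∂μ) * ∫ a, V a ∂μ := by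
  have h : IndepFun U V μ := by
    rw [IndepFun_iff_Indep]
    exact indep_of_indep_of_le hN.indep_past_next hU.comap_le hV.comap_le
  exact h.integral_fun_mul_eq_mul_integral (hU.mono hN.past_le le_rfl).aestronglyMeasurable
    (hV.mono hN.next_le le_rfl).aestronglyMeasurable

lemma measurable_X (k : ℕ) : Measurable (X N k) :=
  (measurable_X_past le_rfl).mono hN.past_le le_rfl

end IsNoise

end Independence

/-! ### Laws of the sources and conditional law of a step. -/

/-- Almost surely the walk uses only finitely many step values, so functions of a step need no
boundedness assumption to be integrated. -/
lemma exists_norm_le_on_steps {E : Type*} [Norm E] (f : ℂ → E) :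
    ∃ C, ∀ v ∈ steps, ‖f v‖ ≤ C := by
  obtain ⟨C, hC⟩ := (finite_steps.image fun v => ‖f v‖).bddAbove
  exact ⟨C, fun v hv => hC ⟨v, hv, rfl⟩⟩

lemma ae_mem_steps_uniformOn : ∀ᵐ v ∂(uniformOn steps : Measure ℂ), v ∈ steps :=
  ae_cond_mem measurableSet_steps

lemma moveLaw_keep (p : ℝ) : moveLaw p {.keep} = ENNReal.ofReal (p / 2) := by
  simp [moveLaw]

lemma moveLaw_negate (p : ℝ) : moveLaw p {.negate} = ENNReal.ofReal (p / 2) := by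
  simp [moveLaw]

lemma moveLaw_fresh (p : ℝ) : moveLaw p {.fresh} = ENNReal.ofReal (1 - p) := by
  simp [moveLaw]

section Sources

variable {Ω : Type*} {N : (s : Source) → Ω → s.Val} {n : ℕ}

lemma measurable_pick : Measurable[next N n] (pick N n) :=
  measurable_next (s := .pick n) rfl

lemma measurable_move : Measurable[next N n] (move N n) :=
  measurable_next (s := .move n) rfl

lemma measurable_fresh : Measurable[next N n] (fresh N n) :=
  measurable_next (s := .fresh n) rfl

lemma measurableSet_choice (i : Fin (n + 1)) (m : Move) :
    MeasurableSet[next N n] (choice N n i m) :=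
  MeasurableSet.inter (measurable_pick (measurableSet_singleton i))
    (measurable_move (measurableSet_singleton m))

lemma measurable_indicator_choice {M : Type*} [MeasurableSpace M] [Zero M] [One M]
    (i : Fin (n + 1)) (m : Move) :
    Measurable[next N n] ((choice N n i m).indicator (1 : Ω → M)) :=
  (@measurable_const M Ω _ (next N n) 1).indicator (measurableSet_choice i m)

end Sources

lemma integral_indicator_one_rclike {α 𝕜 : Type*} [RCLike 𝕜] [MeasurableSpace α] {μ : Measure α}
    {s : Set α} (hs : MeasurableSet s) :
    ∫ a, s.indicator (1 : α → 𝕜) a ∂μ = (μ.real s : 𝕜) :=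
  (integral_indicator_const (1 : 𝕜) hs).trans (by simp [RCLike.real_smul_eq_coe_mul])

namespace IsNoise

variable {Ω : Type*} {N : (s : Source) → Ω → s.Val} {n : ℕ}
  [mΩ : MeasurableSpace Ω] {p : ℝ} {μ : Measure Ω} {𝕜 : Type*} [RCLike 𝕜]
  (hN : IsNoise p N μ)
include hN

lemma ae_fresh_mem_steps (n : ℕ) : ∀ᵐ a ∂μ, fresh N n a ∈ steps := by
  have h : HasLaw (fresh N n) (uniformOn steps) μ := hN.hasLaw (.fresh n)
  exact (h.ae_iff (p := fun v => v ∈ steps) measurableSet_steps.mem).2 ae_mem_steps_uniformOn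

lemma ae_first_mem_steps : ∀ᵐ a ∂μ, X N 0 a ∈ steps := by
  have h : HasLaw (X N 0) (uniformOn steps) μ := by
    rw [funext (X_zero N)]; exact hN.hasLaw .first
  exact (h.ae_iff (p := fun v => v ∈ steps) measurableSet_steps.mem).2 ae_mem_steps_uniformOn

lemma ae_X_mem_steps : ∀ᵐ a ∂μ, ∀ k, X N k a ∈ steps := by
  filter_upwards [hN.ae_first_mem_steps, ae_all_iff.2 hN.ae_fresh_mem_steps] with a h0 h1 k
  induction k using Nat.strong_induction_on with
  | _ k ih =>
    rcases k with _ | k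
    · exact h0
    · rcases h : move N k a with _ | _ | _
      · rw [X_succ_keep N k h]; exact ih _ (pick N k a).2
      · rw [X_succ_negate N k h]; exact neg_mem_steps (ih _ (pick N k a).2)
      · rw [X_succ_fresh N k h]; exact h1 k

lemma measureReal_choice (i : Fin (n + 1)) (m : Move) :
    μ.real (choice N n i m) = (1 / (n + 1)) * (moveLaw p).real {m} := by
  have hlp : HasLaw (pick N n) (uniformOn Set.univ) μ := hN.hasLaw (.pick n)
  have hlm : HasLaw (move N n) (moveLaw p) μ := hN.hasLaw (.move n)
  have hi : IndepFun (pick N n) (move N n) μ :=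
    hN.indep.indepFun (i := .pick n) (j := .move n) (by simp)
  have h1 : μ (pick N n ⁻¹' {i}) = (n + 1 : ENNReal)⁻¹ := by
    have := hlp.measure_eq (p := fun x => x = i) (measurableSet_singleton i)
    refine this.trans ?_
    rw [uniformOn_univ]
    simp
  have h2 : μ (move N n ⁻¹' {m}) = moveLaw p {m} :=
    hlm.measure_eq (p := fun x => x = m) (measurableSet_singleton m)
  have h := hi.measure_inter_preimage_eq_mul _ _ (measurableSet_singleton i)
    (measurableSet_singleton m)
  rw [h1, h2] at h
  rw [Measure.real, show choice N n i m = pick N n ⁻¹' {i} ∩ move N n ⁻¹' {m} from rfl, h,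
    ENNReal.toReal_mul, Measure.real, ENNReal.toReal_inv]
  norm_num
  left
  rw [ENNReal.toReal_add (by simp) (by simp)]; simp

lemma integral_indicator_choice (i : Fin (n + 1)) (m : Move) :
    ∫ a, (choice N n i m).indicator (1 : Ω → 𝕜) a ∂μ
      = ((1 / (n + 1) * (moveLaw p).real {m} : ℝ) : 𝕜) := by
  rw [integral_indicator_one_rclike (hN.next_le _ (measurableSet_choice i m)),
    hN.measureReal_choice]

lemma integral_fresh [IsProbabilityMeasure μ] (hp : p ≤ 1) {f : ℂ → 𝕜} (hf : Measurable f) :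
    ∫ a, {a | move N n a = .fresh}.indicator (fun a => f (fresh N n a)) a ∂μ
      = ((1 - p : ℝ) : 𝕜) * stepMean f := by
  have hm : Measurable (move N n) := hN.measurable (.move n)
  have hfr : Measurable (fresh N n) := hN.measurable (.fresh n)
  have hlf : HasLaw (fresh N n) (uniformOn steps) μ := hN.hasLaw (.fresh n)
  have hlm : HasLaw (move N n) (moveLaw p) μ := hN.hasLaw (.move n)
  have hi : IndepFun (move N n) (fresh N n) μ :=
    hN.indep.indepFun (i := .move n) (j := .fresh n) (by simp)
  have h := hi.integral_fun_comp_mul_comp (f := ({.fresh} : Set Move).indicator (1 : Move → 𝕜))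
    (g := f) hm.aemeasurable hfr.aemeasurable
    (measurable_one.indicator (measurableSet_singleton _)).aestronglyMeasurable
    hf.aestronglyMeasurable
  have h1 : ∫ a, ({.fresh} : Set Move).indicator (1 : Move → 𝕜) (move N n a) ∂μ
      = ((1 - p : ℝ) : 𝕜) := by
    have := hlm.integral_comp (f := ({.fresh} : Set Move).indicator (1 : Move → 𝕜))
      (measurable_one.indicator (measurableSet_singleton _)).aestronglyMeasurable
    refine this.trans ?_
    rw [integral_indicator_one_rclike (measurableSet_singleton _), Measure.real, moveLaw_fresh,
      ENNReal.toReal_ofReal (by linarith)]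
  have h2 : ∫ a, f (fresh N n a) ∂μ = stepMean f :=
    (hlf.integral_comp hf.aestronglyMeasurable).trans (integral_uniformOn_steps f)
  rw [h1, h2] at h
  rw [← h]
  refine integral_congr_ae (.of_forall fun a => ?_)
  by_cases ha : move N n a = .fresh <;> simp [ha]

lemma integrable_mul_comp_X {G : Ω → 𝕜} (hG : Integrable G μ) {f : ℂ → 𝕜} (hf : Measurable f)
    (k : ℕ) : Integrable (fun a => G a * f (X N k a)) μ := by
  obtain ⟨C, hC⟩ := exists_norm_le_on_steps f
  refine hG.mul_bdd (c := C) (hf.comp (hN.measurable_X k)).aestronglyMeasurable ?_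
  filter_upwards [hN.ae_X_mem_steps] with a ha using hC _ (ha k)

/-- The conditional law of a step given the past. -/
theorem integral_mul_comp_X_succ [IsProbabilityMeasure μ] (hp0 : 0 ≤ p) (hp1 : p ≤ 1)
    {G : Ω → 𝕜} (hG : Measurable[past N n] G) (hGi : Integrable G μ)
    {f : ℂ → 𝕜} (hf : Measurable f) :
    ∫ a, G a * f (X N (n + 1) a) ∂μ =
      ((p / 2 / (n + 1) : ℝ) : 𝕜)
        * (∑ i ∈ Finset.range (n + 1), ∫ a, G a * (f (X N i a) + f (-X N i a)) ∂μ)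
      + ((1 - p : ℝ) : 𝕜) * ((∫ a, G a ∂μ) * stepMean f) := by
  have hfn : Measurable fun v => f (-v) := hf.comp measurable_neg
  have hint (m : Move) (i : Fin (n + 1)) {g : ℂ → 𝕜} (hg : Measurable g) :
      Integrable (fun a => G a * (g (X N i a)) * (choice N n i m).indicator 1 a) μ := by
    refine (hN.integrable_mul_comp_X hGi hg i).mul_bdd (c := 1)
      ((measurable_indicator_choice i m).mono hN.next_le le_rfl).aestronglyMeasurable
      (.of_forall fun a => ?_)
    by_cases h : a ∈ choice N n i m <;> simp [h]
  have heval (m : Move) (hm : (moveLaw p).real {m} = p / 2) (i : Fin (n + 1)) {g : ℂ → 𝕜}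
      (hg : Measurable g) :
      ∫ a, G a * (g (X N i a)) * (choice N n i m).indicator 1 a ∂μ
        = ((p / 2 / (n + 1) : ℝ) : 𝕜) * ∫ a, G a * g (X N i a) ∂μ := by
    have hi : (i : ℕ) ≤ n := by omega
    rw [hN.integral_mul (U := fun a => G a * g (X N i a))
      (hG.mul (hg.comp (measurable_X_past hi))) (measurable_indicator_choice i m), hN.integral_indicator_choice, hm,
      mul_comm]
    congr 2
    ring
  have hfr : Measurable[next N n]
      ({a | move N n a = .fresh}.indicator fun a => f (fresh N n a)) :=
    (hf.comp measurable_fresh).indicator (measurable_move (measurableSet_singleton _))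
  have hfri : Integrable
      (fun a => G a * {a | move N n a = .fresh}.indicator (fun a => f (fresh N n a)) a) μ := by
    obtain ⟨C, hC⟩ := exists_norm_le_on_steps f
    refine hGi.mul_bdd (c := C) (hfr.mono hN.next_le le_rfl).aestronglyMeasurable ?_
    filter_upwards [hN.ae_fresh_mem_steps n] with a ha
    exact (norm_indicator_le_norm_self _ _).trans (hC _ ha)
  have hk : (moveLaw p).real {.keep} = p / 2 := by
    rw [Measure.real, moveLaw_keep, ENNReal.toReal_ofReal (by linarith)]
  have hne : (moveLaw p).real {.negate} = p / 2 := by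
    rw [Measure.real, moveLaw_negate, ENNReal.toReal_ofReal (by linarith)]
  have hadd (i : Fin (n + 1)) : Integrable (fun a =>
      G a * f (X N i a) * (choice N n i .keep).indicator 1 a
        + G a * f (-X N i a) * (choice N n i .negate).indicator 1 a) μ :=
    (hint _ i hf).add (hint _ i hfn)
  simp_rw [comp_X_succ N n f, mul_add, Finset.mul_sum, mul_add, ← mul_assoc]
  rw [integral_add (integrable_finsetSum _ fun i _ => hadd i) hfri,
    integral_finsetSum _ fun i _ => hadd i,
    hN.integral_mul hG hfr, hN.integral_fresh hp1 hf, Finset.sum_range]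
  congr 1
  · refine Finset.sum_congr rfl fun i _ => ?_
    rw [integral_add (hint _ i hf) (hint _ i hfn), heval _ hk i hf, heval _ hne i hfn,
      integral_add (hN.integrable_mul_comp_X hGi hf i) (hN.integrable_mul_comp_X hGi hfn i),
      mul_add]
  · ring

end IsNoise

/-! ### Growth and convergence of sequences. -/

/-- With `x = n + 1`, the factor contributes `2q / x` and the added `A` costs at most a further `(1
- q) / x`. The total `(1 + q) / x` is what Bernoulli's inequality allows for the power `1 + q`. The
exponent is not optimal, but it is below `2`. -/
lemma le_rpow_of_recurrence {q A : ℝ} (hq0 : 0 ≤ q) (hq1 : q < 1) (hA : 0 ≤ A) {u : ℕ → ℝ}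
    (h0 : u 0 ≤ A) (h : ∀ n, u (n + 1) ≤ (1 + 2 * (q / (n + 1))) * u n + A) (n : ℕ) :
    u n ≤ A / (1 - q) * ((n : ℝ) + 1) ^ (1 + q) := by
  have hq : 0 < 1 - q := by linarith
  have hC : A ≤ A / (1 - q) := by
    rw [le_div_iff₀ hq]; nlinarith
  induction n with
  | zero => simpa using h0.trans hC
  | succ n ih =>
    have hx : (0 : ℝ) < n + 1 := by positivity
    set x : ℝ := n + 1 with hxdef
    have hbern : 1 + (1 + q) * (1 / x) ≤ (1 + 1 / x) ^ (1 + q) :=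
      one_add_mul_self_le_rpow_one_add (by have : 0 < 1 / x := by positivity
                                           linarith) (by linarith)
    have hpow : x ^ (1 + q) * (1 + (1 + q) * (1 / x)) ≤ (x + 1) ^ (1 + q) := by
      calc _ ≤ x ^ (1 + q) * (1 + 1 / x) ^ (1 + q) := by gcongr
        _ = (x + 1) ^ (1 + q) := by
          rw [← Real.mul_rpow hx.le (by positivity)]
          congr 1
          field_simp
    have hxq : 1 ≤ x ^ (1 + q) * (1 / x) := by
      rw [Real.rpow_add hx, Real.rpow_one]
      have : 1 ≤ x ^ q := Real.one_le_rpow (by simp [hxdef]) hq0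
      field_simp
      linarith
    have hA' : A ≤ A / (1 - q) * ((1 - q) * (x ^ (1 + q) * (1 / x))) := by
      rw [← mul_assoc, div_mul_cancel₀ _ hq.ne']
      exact le_mul_of_one_le_right hA hxq
    have hcoef : 0 ≤ 1 + 2 * (q / x) := by positivity
    push_cast
    rw [← hxdef]
    calc u (n + 1) ≤ (1 + 2 * (q / x)) * u n + A := h n
      _ ≤ (1 + 2 * (q / x)) * (A / (1 - q) * x ^ (1 + q))
          + A / (1 - q) * ((1 - q) * (x ^ (1 + q) * (1 / x))) := by gcongr
      _ = A / (1 - q) * (x ^ (1 + q) * (1 + (1 + q) * (1 / x))) := by ring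
      _ ≤ _ := by gcongr

/-- The sum of the series has finite integral, hence is almost surely finite. -/
lemma ae_tendsto_zero_of_summable_integral {Ω : Type*} [MeasurableSpace Ω] {μ : Measure Ω}
    {f : ℕ → Ω → ℝ} (hf0 : ∀ n a, 0 ≤ f n a) (hf : ∀ n, Integrable (f n) μ)
    (hs : Summable fun n => ∫ a, f n a ∂μ) :
    ∀ᵐ a ∂μ, Tendsto (fun n => f n a) atTop (𝓝 0) := by
  have hm (n : ℕ) : AEMeasurable (fun a => ENNReal.ofReal (f n a)) μ :=
    (hf n).aemeasurable.ennreal_ofReal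
  have hfin : ∫⁻ a, ∑' n, ENNReal.ofReal (f n a) ∂μ ≠ ⊤ := by
    rw [lintegral_tsum hm]
    simp_rw [← fun n => ofReal_integral_eq_lintegral_ofReal (hf n) (.of_forall (hf0 n))]
    exact hs.tsum_ofReal_ne_top
  filter_upwards [ae_lt_top' (AEMeasurable.tsum hm) hfin] with a ha
  have h := ENNReal.tendsto_atTop_zero_of_tsum_ne_top ha.ne
  have h2 := (ENNReal.tendsto_toReal ENNReal.zero_ne_top).comp h
  simpa [Function.comp_def, ENNReal.toReal_ofReal (hf0 _ a)] using h2

lemma tendsto_nat_sqrt_atTop : Tendsto Nat.sqrt atTop atTop :=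
  tendsto_atTop_atTop.2 fun b => ⟨b * b, fun _ h => Nat.le_sqrt.2 h⟩

/-- With `m = Nat.sqrt n`, the distance from `m ^ 2` to `n` is at most `2 * m`, negligible against
`m ^ 2`. -/
lemma tendsto_div_of_tendsto_sq {d : ℕ → ℝ} {B : ℝ} (hd : ∀ n, |d (n + 1) - d n| ≤ B)
    (h : Tendsto (fun n : ℕ => d (n ^ 2) / (n ^ 2 : ℝ)) atTop (𝓝 0)) :
    Tendsto (fun n : ℕ => d n / n) atTop (𝓝 0) := by
  have hB : 0 ≤ B := (abs_nonneg _).trans (hd 0)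
  have hlip (m k : ℕ) : |d (m + k) - d m| ≤ B * k := by
    induction k with
    | zero => simp
    | succ k ih =>
      have := hd (m + k)
      have h3 := abs_sub_le (d (m + (k + 1))) (d (m + k)) (d m)
      rw [← add_assoc] at h3 ⊢
      push_cast
      linarith
  have hlim : Tendsto (fun m : ℕ => |d (m ^ 2) / (m ^ 2 : ℝ)| + 2 * B * (m : ℝ)⁻¹) atTop (𝓝 0) := by
    simpa using h.abs.add (tendsto_inv_atTop_nhds_zero_nat.const_mul (2 * B))
  refine squeeze_zero_norm' ?_ (hlim.comp tendsto_nat_sqrt_atTop)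
  filter_upwards [eventually_ge_atTop 1] with n hn
  set m := Nat.sqrt n with hm
  have hm1 : 1 ≤ m := Nat.sqrt_pos.2 hn
  have hle : m ^ 2 ≤ n := Nat.sqrt_le' n
  obtain ⟨k, hk⟩ := Nat.exists_eq_add_of_le hle
  have hk2 : k ≤ 2 * m := by
    have := Nat.sqrt_le_add n
    rw [← hm] at this
    nlinarith
  have hk2' : (k : ℝ) ≤ 2 * m := by exact_mod_cast hk2
  have hmpos : (0 : ℝ) < m := by exact_mod_cast hm1
  have hle' : (m : ℝ) ^ 2 ≤ n := by exact_mod_cast hle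
  have h1 : |d n| ≤ |d (m ^ 2)| + B * (2 * m) := by
    have h2 := hlip (m ^ 2) k
    rw [← hk] at h2
    have h3 : B * k ≤ B * (2 * m) := by gcongr
    have h4 := abs_sub_abs_le_abs_sub (d n) (d (m ^ 2))
    linarith
  have hn0 : (0 : ℝ) < n := by exact_mod_cast hn
  rw [Real.norm_eq_abs, abs_div, abs_of_pos hn0, Function.comp_apply, abs_div,
    abs_of_pos (by positivity : (0 : ℝ) < (m : ℝ) ^ 2)]
  calc |d n| / n ≤ (|d (m ^ 2)| + B * (2 * m)) / (m : ℝ) ^ 2 := by gcongr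
    _ = |d (m ^ 2)| / (m : ℝ) ^ 2 + 2 * B * (m : ℝ)⁻¹ := by field_simp

/-! ### Second moments of sums along the walk, and the strong law. -/

/-- The sum of `f` over the first `n` steps. -/
noncomputable def stepSum {Ω E : Type*} [AddCommMonoid E] (N : (s : Source) → Ω → s.Val)
    (f : ℂ → E) (n : ℕ) (a : Ω) : E :=
  ∑ i ∈ Finset.range n, f (X N i a)

namespace IsNoise

variable {Ω : Type*} {N : (s : Source) → Ω → s.Val} {n : ℕ}
  [mΩ : MeasurableSpace Ω] {p : ℝ} {μ : Measure Ω}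
  (hN : IsNoise p N μ)
include hN

omit hN mΩ in
lemma measurable_stepSum_past {E : Type*} [MeasurableSpace E] [AddCommMonoid E] [MeasurableAdd₂ E]
    {f : ℂ → E} (hf : Measurable f) : Measurable[past N n] (stepSum N f (n + 1)) := by
  unfold stepSum
  refine @Finset.measurable_fun_sum _ _ _ _ _ _ (past N n) _ _ fun i hi => ?_
  exact hf.comp (measurable_X_past (by simpa [Nat.lt_succ_iff] using hi))

lemma measurable_stepSum {E : Type*} [MeasurableSpace E] [AddCommMonoid E] [MeasurableAdd₂ E]
    {f : ℂ → E} (hf : Measurable f) (n : ℕ) : Measurable (stepSum N f n) :=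
  Finset.measurable_fun_sum _ fun i _ => hf.comp (hN.measurable_X i)

lemma ae_norm_stepSum_le {E : Type*} [SeminormedAddCommGroup E] {f : ℂ → E} {B : ℝ}
    (hB : ∀ v ∈ steps, ‖f v‖ ≤ B) : ∀ᵐ a ∂μ, ∀ n, ‖stepSum N f n a‖ ≤ n * B := by
  filter_upwards [hN.ae_X_mem_steps] with a ha n
  calc ‖stepSum N f n a‖ ≤ ∑ i ∈ Finset.range n, ‖f (X N i a)‖ := norm_sum_le _ _
    _ ≤ ∑ i ∈ Finset.range n, B := by gcongr with i; exact hB _ (ha i)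
    _ = n * B := by simp

variable [IsProbabilityMeasure μ]

/-- Suppose that `f` has mean zero over the steps, and that it is odd (`c = 0`) or even
(`c = 1`). Then its sums along the walk have second moments of order less than two. -/
theorem integral_stepSum_sq_le (hp0 : 0 ≤ p) (hp1 : p ≤ 1) {f : ℂ → ℝ} (hf : Measurable f)
    {B c : ℝ} (hc : 0 ≤ c) (hpc : p * c < 1) (hB : ∀ v ∈ steps, |f v| ≤ B)
    (hfc : ∀ v ∈ steps, f v + f (-v) = 2 * c * f v) (hmean : stepMean f = 0) (n : ℕ) :
    ∫ a, stepSum N f n a ^ 2 ∂μ ≤ B ^ 2 / (1 - p * c) * (n : ℝ) ^ (1 + p * c) := by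
  have hint (n : ℕ) : Integrable (stepSum N f n) μ :=
    .of_bound (hN.measurable_stepSum hf n).aestronglyMeasurable _
      ((ae_all_iff.1 (hN.ae_norm_stepSum_le hB)) n)
  have hint2 (n : ℕ) : Integrable (fun a => stepSum N f n a ^ 2) μ := by
    simp_rw [sq]
    exact (hint n).mul_bdd (hN.measurable_stepSum hf n).aestronglyMeasurable
      ((ae_all_iff.1 (hN.ae_norm_stepSum_le hB)) n)
  have hfX (n : ℕ) : Integrable (fun a => f (X N n a) ^ 2) μ := by
    simpa using hN.integrable_mul_comp_X (𝕜 := ℝ) (integrable_const 1) (hf.pow_const 2) n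
  have hsq (n : ℕ) : ∫ a, f (X N n a) ^ 2 ∂μ ≤ B ^ 2 := by
    have h := integral_mono_ae (hfX n) (integrable_const (B ^ 2)) (by
      filter_upwards [hN.ae_X_mem_steps] with a ha
      exact sq_le_sq' (neg_le_of_abs_le (hB _ (ha n))) (le_of_abs_le (hB _ (ha n))))
    simpa using h
  -- Each past step enters with weight `p / 2 / (n + 1)` and value `2 * c * f`, so together they
  -- rebuild a multiple of the sum itself.
  have hcross (n : ℕ) : ∫ a, stepSum N f (n + 1) a * f (X N (n + 1) a) ∂μ
      = p * c / (n + 1) * ∫ a, stepSum N f (n + 1) a ^ 2 ∂μ := by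
    rw [hN.integral_mul_comp_X_succ hp0 hp1 (measurable_stepSum_past hf) (hint _) hf, hmean,
      mul_zero, mul_zero, add_zero, ← integral_finsetSum]
    · have : ∀ᵐ a ∂μ, ∑ i ∈ Finset.range (n + 1), stepSum N f (n + 1) a
          * (f (X N i a) + f (-X N i a)) = 2 * c * stepSum N f (n + 1) a ^ 2 := by
        filter_upwards [hN.ae_X_mem_steps] with a ha
        rw [← Finset.mul_sum, Finset.sum_congr rfl fun i _ => hfc _ (ha i), ← Finset.mul_sum,
          sq, stepSum]
        ring
      rw [integral_congr_ae this, integral_const_mul]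
      simp only [RCLike.ofReal_real_eq_id, id_eq]
      ring
    · intro i _
      exact hN.integrable_mul_comp_X (f := fun v => f v + f (-v)) (hint _)
        (hf.add (hf.comp measurable_neg)) i
  rcases n with _ | n
  · have : (0 : ℝ) < 1 + p * c := by positivity
    simp [stepSum, Real.zero_rpow this.ne']
  -- The recurrence starts at one step, because the first step has nothing to recall.
  · have hrec := le_rpow_of_recurrence (q := p * c) (A := B ^ 2) (by positivity) hpc (sq_nonneg B)
      (u := fun n => ∫ a, stepSum N f (n + 1) a ^ 2 ∂μ) (by simpa [stepSum] using hsq 0)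
      (fun n => ?_) n
    · simpa using hrec
    · have hexp (a : Ω) : stepSum N f (n + 1 + 1) a ^ 2 = stepSum N f (n + 1) a ^ 2
          + 2 * (stepSum N f (n + 1) a * f (X N (n + 1) a)) + f (X N (n + 1) a) ^ 2 := by
        rw [stepSum, Finset.sum_range_succ, ← stepSum]; ring
      have hi : Integrable (fun a => 2 * (stepSum N f (n + 1) a * f (X N (n + 1) a))) μ :=
        (hN.integrable_mul_comp_X (hint _) hf _).const_mul 2
      simp_rw [hexp]
      have hi2 : Integrable (fun a => stepSum N f (n + 1) a ^ 2
          + 2 * (stepSum N f (n + 1) a * f (X N (n + 1) a))) μ := (hint2 _).add hi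
      rw [integral_add hi2 (hfX _), integral_add (hint2 _) hi, integral_const_mul, hcross]
      linarith [hsq (n + 1)]

/-- The strong law of large numbers for the sums of an odd function along the walk. -/
theorem ae_tendsto_stepSum_div (hp0 : 0 ≤ p) (hp1 : p ≤ 1) {f : ℂ → ℝ} (hf : Measurable f)
    (hodd : ∀ v, f (-v) = -f v) :
    ∀ᵐ a ∂μ, Tendsto (fun n : ℕ => stepSum N f n a / n) atTop (𝓝 0) := by
  obtain ⟨B, hB⟩ := exists_norm_le_on_steps f
  have hmean : stepMean f = 0 := by
    rw [stepMean_of_add_neg (c := 0) fun v _ => by rw [hodd, add_neg_cancel], zero_div]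
  have hmom (n : ℕ) : ∫ a, stepSum N f n a ^ 2 ∂μ ≤ B ^ 2 * n := by
    simpa using hN.integral_stepSum_sq_le hp0 hp1 hf le_rfl (by simp) hB
      (fun v _ => by simp [hodd]) hmean n
  have hint (n : ℕ) : Integrable (fun a => (stepSum N f (n ^ 2) a / (n ^ 2 : ℝ)) ^ 2) μ := by
    simp_rw [div_pow]
    refine Integrable.div_const (.of_bound
      ((hN.measurable_stepSum hf _).pow_const 2).aestronglyMeasurable (((n ^ 2 : ℕ) * B) ^ 2) ?_) _
    filter_upwards [hN.ae_norm_stepSum_le hB] with a ha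
    rw [norm_pow]
    gcongr
    exact ha _
  -- Along the squares the normalised second moment is at most `B ^ 2 / n ^ 2`.
  have hsum : Summable fun n : ℕ => ∫ a, (stepSum N f (n ^ 2) a / (n ^ 2 : ℝ)) ^ 2 ∂μ := by
    refine .of_nonneg_of_le (fun n => integral_nonneg fun a => sq_nonneg _) (fun n => ?_)
      ((Real.summable_nat_pow_inv.2 one_lt_two).mul_left (B ^ 2))
    simp_rw [div_pow]
    rw [integral_div]
    rcases Nat.eq_zero_or_pos n with rfl | hn
    · simp
    · have hn' : (0 : ℝ) < n := by exact_mod_cast hn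
      rw [div_le_iff₀ (by positivity)]
      refine (hmom _).trans (le_of_eq ?_)
      push_cast
      field_simp
  filter_upwards [ae_tendsto_zero_of_summable_integral (fun n a => sq_nonneg _) hint hsum,
    hN.ae_X_mem_steps] with a ha hX
  refine tendsto_div_of_tendsto_sq (d := fun n => stepSum N f n a) (B := B) (fun n => ?_) ?_
  · simp only [stepSum, Finset.sum_range_succ, add_sub_cancel_left]
    exact hB _ (hX n)
  · have h := ha.sqrt
    simp only [Real.sqrt_sq_eq_abs, Real.sqrt_zero] at h
    exact (tendsto_zero_iff_abs_tendsto_zero _).2 h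

theorem ae_tendsto_S_div (hp0 : 0 ≤ p) (hp1 : p ≤ 1) :
    ∀ᵐ a ∂μ, Tendsto (fun n : ℕ => S N n a / (n : ℂ)) atTop (𝓝 0) := by
  filter_upwards [hN.ae_tendsto_stepSum_div hp0 hp1 Complex.measurable_re Complex.neg_re,
    hN.ae_tendsto_stepSum_div hp0 hp1 Complex.measurable_im Complex.neg_im] with a hre him
  have h := ((Complex.continuous_ofReal.tendsto 0).comp hre).add
    (((Complex.continuous_ofReal.tendsto 0).comp him).mul_const Complex.I)
  simp only [Complex.ofReal_zero, zero_mul, add_zero] at h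
  refine h.congr fun n => ?_
  conv_rhs => rw [← Complex.re_add_im (S N n a / n)]
  simp [stepSum, S, Complex.div_natCast_re, Complex.div_natCast_im]

end IsNoise

/-! ### The multiplicative martingale and the comparison of characteristic functions. -/

lemma stepMean_sub_const {f : ℂ → ℝ} (c : ℝ) : stepMean (fun v => f v - c) = stepMean f - c := by
  simp only [stepMean, Finset.sum_sub_distrib, Finset.sum_const, card_stepsFinset]
  simp only [nsmul_eq_mul]
  push_cast
  ring

lemma stepMean_mem_Icc {f : ℂ → ℝ} {M : ℝ} (h : ∀ v ∈ steps, f v ∈ Set.Icc 0 M) :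
    stepMean f ∈ Set.Icc 0 M := by
  constructor
  · exact div_nonneg (Finset.sum_nonneg fun v hv => (h v (mem_stepsFinset.1 hv)).1) (by norm_num)
  · rw [stepMean, div_le_iff₀ (by norm_num)]
    refine (Finset.sum_le_card_nsmul _ _ M fun v hv => (h v (mem_stepsFinset.1 hv)).2).trans ?_
    rw [card_stepsFinset, nsmul_eq_mul]
    push_cast
    linarith

/-- The lattice is isotropic to second order: the squared inner products sum to `3 * ‖t‖ ^ 2`. This
fixes the covariance of the limit. -/
lemma stepMean_inner_sq (t : ℂ) : stepMean (fun v => inner ℝ v t ^ 2 / 2) = ‖t‖ ^ 2 / 4 := by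
  have h3 : √3 ^ 2 = 3 := Real.sq_sqrt (by norm_num)
  rw [stepMean, sum_stepsFinset, Complex.sq_norm, Complex.normSq_apply]
  simp only [inner_neg_left, ω_sq_eq]
  simp only [ω_eq, Complex.inner, Complex.mul_re, Complex.conj_re, Complex.conj_im,
    Complex.one_re, Complex.one_im]
  ring_nf
  rw [h3]
  ring

namespace IsNoise

variable {Ω : Type*} {N : (s : Source) → Ω → s.Val} {n : ℕ}
  [mΩ : MeasurableSpace Ω] {p : ℝ} {μ : Measure Ω} [IsProbabilityMeasure μ]
  (hN : IsNoise p N μ)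
include hN

lemma integrable_prod_comp_X {R : ℂ → ℂ} (hR : Measurable R) (n : ℕ) :
    Integrable (fun a => ∏ k ∈ Finset.range n, R (X N k a)) μ := by
  induction n with
  | zero => simp
  | succ n ih =>
    simp_rw [Finset.prod_range_succ]
    exact hN.integrable_mul_comp_X ih hR n

/-- The multiplicative martingale attached to a function whose even part is `1`. -/
lemma integral_prod_comp_X (hp0 : 0 ≤ p) (hp1 : p ≤ 1) {R : ℂ → ℂ} (hR : Measurable R)
    (h : ∀ v ∈ steps, R v + R (-v) = 2) (n : ℕ) :
    ∫ a, ∏ k ∈ Finset.range n, R (X N k a) ∂μ = 1 := by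
  have hmean : stepMean R = 1 := by rw [stepMean_of_add_neg h]; norm_num
  rcases n with _ | n
  · simp
  induction n with
  | zero =>
    have hl : HasLaw (X N 0) (uniformOn steps) μ := by
      rw [funext (X_zero N)]; exact hN.hasLaw .first
    simpa [hmean, integral_uniformOn_steps] using hl.integral_comp hR.aestronglyMeasurable
  | succ n ih =>
    have hG : Measurable[past N n] fun a => ∏ k ∈ Finset.range (n + 1), R (X N k a) := by
      refine @Finset.measurable_fun_prod _ _ _ _ _ _ (past N n) _ _ fun i hi => ?_
      exact hR.comp (measurable_X_past (by simpa [Nat.lt_succ_iff] using hi))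
    -- Keeping and negating a recalled step together give `2`, so the memory contributes `p` and the
    -- fresh step `1 - p`, with total `1`.
    have hG2 (i : ℕ) : ∫ a, (∏ k ∈ Finset.range (n + 1), R (X N k a))
        * (R (X N i a) + R (-X N i a)) ∂μ = 2 := by
      have : ∀ᵐ a ∂μ, (∏ k ∈ Finset.range (n + 1), R (X N k a))
        * (R (X N i a) + R (-X N i a)) = (∏ k ∈ Finset.range (n + 1), R (X N k a)) * 2 := by
        filter_upwards [hN.ae_X_mem_steps] with a ha
        rw [h _ (ha i)]
      rw [integral_congr_ae this, integral_mul_const, ih, one_mul]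
    simp_rw [Finset.prod_range_succ _ (n + 1)]
    rw [hN.integral_mul_comp_X_succ hp0 hp1 hG (hN.integrable_prod_comp_X hR _) hR, ih, hmean,
      Finset.sum_congr rfl fun i _ => hG2 i]
    have hn : (n + 1 : ℂ) ≠ 0 := by exact_mod_cast Nat.succ_ne_zero n
    simp only [Finset.sum_const, Finset.card_range, nsmul_eq_mul, RCLike.ofReal_eq_complex_ofReal]
    push_cast
    field_simp
    ring

/-- A quantitative comparison of a characteristic function of the walk with that of independent
steps. -/
theorem norm_integral_exp_stepSum_sub_le (hp0 : 0 ≤ p) (hp1 : p < 1) {θ : ℂ → ℝ}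
    (hθ : Measurable θ) (hodd : ∀ v, θ (-v) = -θ v) {M : ℝ}
    (hcos : ∀ v ∈ steps, 0 < Real.cos (θ v))
    (hM : ∀ v ∈ steps, -Real.log (Real.cos (θ v)) ≤ M) (n : ℕ) :
    ‖∫ a, Complex.exp (stepSum N θ n a * Complex.I) ∂μ
        - (Real.exp (-(n * stepMean fun v => -Real.log (Real.cos (θ v)))) : ℝ)‖
      ≤ Real.exp (n * M) * √(M ^ 2 / (1 - p) * (n : ℝ) ^ (1 + p)) := by
  set g : ℂ → ℝ := fun v => -Real.log (Real.cos (θ v)) with hg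
  have hgm : Measurable g := (Real.measurable_log.comp (Real.measurable_cos.comp hθ)).neg
  have hgI : ∀ v ∈ steps, g v ∈ Set.Icc 0 M := fun v hv =>
    ⟨neg_nonneg.2 (Real.log_nonpos (hcos v hv).le (Real.cos_le_one _)), hM v hv⟩
  set m := stepMean g with hm
  obtain ⟨hm0, hmM⟩ : m ∈ Set.Icc 0 M := stepMean_mem_Icc hgI
  have hfm : Measurable fun v => g v - m := hgm.sub_const m
  have hfB : ∀ v ∈ steps, |g v - m| ≤ M := fun v hv => by
    obtain ⟨h1, h2⟩ := hgI v hv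
    exact abs_le.2 ⟨by linarith, by linarith⟩
  set D : Ω → ℝ := stepSum N (fun v => g v - m) n with hD
  have hDm : AEStronglyMeasurable D μ := (hN.measurable_stepSum hfm n).aestronglyMeasurable
  have hDlp : MemLp D 2 μ := by
    refine .of_bound hDm (n * M) ?_
    filter_upwards [hN.ae_norm_stepSum_le (f := fun v => g v - m) hfB] with a ha using ha n
  -- `g` is even because cosine is, so the case `c = 1` applies; this is where `p < 1` is needed.
  have hDsq : ∫ a, D a ^ 2 ∂μ ≤ M ^ 2 / (1 - p) * (n : ℝ) ^ (1 + p) := by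
    have := hN.integral_stepSum_sq_le hp0 hp1.le (c := 1) hfm zero_le_one (by simpa using hp1) hfB
      (fun v _ => by simp only [hg, hodd, Real.cos_neg]; ring)
      (by rw [stepMean_sub_const, ← hm, sub_self]) n
    simpa using this
  have hDabs : ∫ a, |D a| ∂μ ≤ √(M ^ 2 / (1 - p) * (n : ℝ) ^ (1 + p)) := by
    refine Real.le_sqrt_of_sq_le (le_trans ?_ hDsq)
    -- Nonnegativity of the variance of `|D|` bounds the first moment by the second.
    have hv := variance_nonneg |D| μ
    rw [variance_eq_sub hDlp.abs] at hv
    simpa [sq_abs] using hv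
  set R : ℂ → ℂ := fun v => Complex.exp (θ v * Complex.I) / (Real.cos (θ v) : ℂ) with hR
  have hRm : Measurable R := by
    refine Measurable.div ?_ (Complex.measurable_ofReal.comp (Real.measurable_cos.comp hθ))
    exact Complex.measurable_exp.comp ((Complex.measurable_ofReal.comp hθ).mul_const _)
  have hRnorm : ∀ v ∈ steps, ‖R v‖ = Real.exp (g v) := fun v hv => by
    rw [hR, norm_div, Complex.norm_exp_ofReal_mul_I, Complex.norm_real, Real.norm_eq_abs,
      abs_of_pos (hcos v hv), hg, Real.exp_neg, Real.exp_log (hcos v hv), one_div]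
  have hReven : ∀ v ∈ steps, R v + R (-v) = 2 := fun v hv => by
    have hc : Complex.cos (θ v) ≠ 0 := by
      rw [← Complex.ofReal_cos]; exact_mod_cast (hcos v hv).ne'
    simp only [hR, hodd, Complex.ofReal_neg, Complex.ofReal_cos, Complex.cos_neg]
    rw [← add_div, div_eq_iff hc, ← Complex.two_cos]
  have hRexp : ∀ v ∈ steps, Complex.exp (θ v * Complex.I) = R v * (Real.exp (-g v) : ℝ) :=
    fun v hv => by
      rw [hg, neg_neg, Real.exp_log (hcos v hv), hR, div_mul_cancel₀]
      exact_mod_cast (hcos v hv).ne'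
  set P : Ω → ℂ := fun a => ∏ k ∈ Finset.range n, R (X N k a) with hP
  have hPi : Integrable P μ := hN.integrable_prod_comp_X hRm n
  have hbd : ∀ᵐ a ∂μ, ‖Complex.exp (stepSum N θ n a * Complex.I) - P a * (Real.exp (-(n * m)) : ℝ)‖
      ≤ Real.exp (n * M) * |D a| := by
    filter_upwards [hN.ae_X_mem_steps] with a ha
    have hsum : Real.exp (-(stepSum N g n a)) = ∏ k ∈ Finset.range n, Real.exp (-g (X N k a)) := by
      rw [← Real.exp_sum, stepSum, ← Finset.sum_neg_distrib]
    have hprod : Complex.exp (stepSum N θ n a * Complex.I)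
        = P a * (Real.exp (-(stepSum N g n a)) : ℝ) := by
      rw [hsum, Complex.ofReal_prod, hP, ← Finset.prod_mul_distrib, stepSum, Complex.ofReal_sum,
        Finset.sum_mul, Complex.exp_sum]
      exact Finset.prod_congr rfl fun k _ => hRexp _ (ha k)
    have hPn : ‖P a‖ ≤ Real.exp (n * M) := by
      rw [hP, norm_prod, Finset.prod_congr rfl fun k _ => hRnorm _ (ha k), ← Real.exp_sum]
      refine Real.exp_le_exp.2 ((Finset.sum_le_card_nsmul _ _ M fun k _ => (hgI _ (ha k)).2).trans ?_)
      simp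
    have hDa : stepSum N g n a - n * m = D a := by
      simp [hD, stepSum, Finset.sum_sub_distrib]
    -- `x ↦ exp (-x)` is 1-Lipschitz on the nonnegative half-line, which contains both arguments.
    have hexp : |Real.exp (-(stepSum N g n a)) - Real.exp (-(n * m))| ≤ |D a| := by
      have h0 : 0 ≤ stepSum N g n a := Finset.sum_nonneg fun k _ => (hgI _ (ha k)).1
      have h1 : 0 ≤ n * m := by positivity
      rw [← hDa]
      generalize stepSum N g n a = x at h0
      generalize (n : ℝ) * m = y at h1
      wlog hxy : x ≤ y generalizing x y
      · rw [abs_sub_comm, abs_sub_comm x]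
        exact this y h1 x h0 (le_of_not_ge hxy)
      rw [abs_of_nonneg (sub_nonneg.2 (Real.exp_le_exp.2 (neg_le_neg hxy))),
        abs_of_nonpos (sub_nonpos.2 hxy)]
      have h2 : Real.exp (-y) = Real.exp (-x) * Real.exp (x - y) := by
        rw [← Real.exp_add]; congr 1; ring
      have h3 : Real.exp (-x) ≤ 1 := Real.exp_le_one_iff.2 (by linarith)
      have h4 := Real.add_one_le_exp (x - y)
      have h5 : Real.exp (x - y) ≤ 1 := Real.exp_le_one_iff.2 (by linarith)
      have h6 := Real.exp_pos (-x)
      rw [h2]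
      nlinarith
    rw [hprod, ← mul_sub, norm_mul, ← Complex.ofReal_sub, Complex.norm_real, Real.norm_eq_abs]
    gcongr
  have hei : Integrable (fun a => Complex.exp (stepSum N θ n a * Complex.I)) μ := by
    refine .of_bound (Complex.measurable_exp.comp ((Complex.measurable_ofReal.comp
      (hN.measurable_stepSum hθ n)).mul_const _)).aestronglyMeasurable 1 (.of_forall fun a => ?_)
    exact (Complex.norm_exp_ofReal_mul_I _).le
  have hP1 : ∫ a, P a * (Real.exp (-(n * m)) : ℝ) ∂μ = (Real.exp (-(n * m)) : ℝ) := by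
    rw [integral_mul_const, hN.integral_prod_comp_X hp0 hp1.le hRm hReven, one_mul]
  rw [← hP1, ← integral_sub hei (hPi.mul_const _)]
  refine (norm_integral_le_of_norm_le ((hDlp.integrable one_le_two).abs.const_mul _) hbd).trans ?_
  rw [integral_const_mul]
  gcongr

end IsNoise

/-! ### Estimates for `-log cos` near zero. -/

lemma half_le_cos {x : ℝ} (hx : x ^ 2 ≤ 1) : 1 / 2 ≤ Real.cos x := by
  have := Real.one_sub_sq_div_two_le_cos (x := x)
  linarith

/-- Combine `cos x ≥ 1 - x ^ 2 / 2` with `-log y ≤ y⁻¹ - 1`. -/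
lemma neg_log_cos_le {x : ℝ} (hx : x ^ 2 ≤ 1) :
    -Real.log (Real.cos x) ≤ x ^ 2 / 2 / (1 - x ^ 2 / 2) := by
  have h := Real.one_sub_sq_div_two_le_cos (x := x)
  have hy : 0 < 1 - x ^ 2 / 2 := by linarith
  have h1 := Real.log_le_log hy h
  have h2 := Real.one_sub_inv_le_log_of_pos hy
  have h3 : x ^ 2 / 2 / (1 - x ^ 2 / 2) = (1 - x ^ 2 / 2)⁻¹ - 1 := by
    have := hy.ne'
    rw [div_eq_iff this, sub_mul, inv_mul_cancel₀ this]
    ring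
  linarith

lemma neg_log_cos_le_sq {x : ℝ} (hx : x ^ 2 ≤ 1) : -Real.log (Real.cos x) ≤ x ^ 2 := by
  refine (neg_log_cos_le hx).trans ?_
  rw [div_le_iff₀ (by linarith)]
  nlinarith [sq_nonneg x]

/-- Combine `-log y ≥ 1 - y` with the fourth-order Taylor bound for the cosine. -/
lemma le_neg_log_cos {x : ℝ} (hx : x ^ 2 ≤ 1) :
    x ^ 2 / 2 - (x ^ 2) ^ 2 ≤ -Real.log (Real.cos x) := by
  have h1 := Real.log_le_sub_one_of_pos (by linarith [half_le_cos hx] : 0 < Real.cos x)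
  have h2 := (abs_le.1 (Real.cos_bound ((sq_le_one_iff_abs_le_one x).1 hx))).2
  have h3 : |x| ^ 4 = (x ^ 2) ^ 2 := by rw [← sq_abs x]; ring
  rw [h3] at h2
  nlinarith [sq_nonneg (x ^ 2)]

lemma tendsto_mul_neg_log_cos (s : ℝ) :
    Tendsto (fun n : ℕ => (n : ℝ) * -Real.log (Real.cos (s / √n))) atTop (𝓝 (s ^ 2 / 2)) := by
  have hinv := tendsto_inv_atTop_nhds_zero_nat (𝕜 := ℝ)
  have hlow : Tendsto (fun n : ℕ => s ^ 2 / 2 - s ^ 4 * (n : ℝ)⁻¹) atTop (𝓝 (s ^ 2 / 2)) := by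
    simpa using (hinv.const_mul (s ^ 4)).const_sub (s ^ 2 / 2)
  have hup : Tendsto (fun n : ℕ => s ^ 2 / 2 / (1 - s ^ 2 / 2 * (n : ℝ)⁻¹)) atTop
      (𝓝 (s ^ 2 / 2)) := by
    have := (tendsto_const_nhds (x := s ^ 2 / 2)).div
      ((hinv.const_mul (s ^ 2 / 2)).const_sub 1) (by simp)
    rw [mul_zero, sub_zero, div_one] at this
    exact this
  have hev : ∀ᶠ n : ℕ in atTop, 0 < (n : ℝ) ∧ (s / √n) ^ 2 ≤ 1 := by
    filter_upwards [eventually_gt_atTop 0, tendsto_natCast_atTop_atTop.eventually_ge_atTop (s ^ 2)]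
      with n hn hs
    have hn' : (0 : ℝ) < n := by exact_mod_cast hn
    refine ⟨hn', ?_⟩
    rwa [div_pow, Real.sq_sqrt hn'.le, div_le_one hn']
  refine tendsto_of_tendsto_of_tendsto_of_le_of_le' hlow hup ?_ ?_
  · filter_upwards [hev] with n ⟨hn, hs⟩
    have h := mul_le_mul_of_nonneg_left (le_neg_log_cos hs) hn.le
    rw [div_pow, Real.sq_sqrt hn.le] at h
    refine le_trans (le_of_eq ?_) h
    field_simp
  · filter_upwards [hev] with n ⟨hn, hs⟩
    have h := mul_le_mul_of_nonneg_left (neg_log_cos_le hs) hn.le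
    rw [div_pow, Real.sq_sqrt hn.le] at h
    refine h.trans (le_of_eq ?_)
    rw [show s ^ 2 / n / 2 = s ^ 2 / 2 * (n : ℝ)⁻¹ by ring]
    generalize 1 - s ^ 2 / 2 * (n : ℝ)⁻¹ = y
    field_simp

/-! ### The Gaussian limit and the convergence in distribution. -/

/-- The limit law: the centred Gaussian law with covariance matrix half the identity. -/
noncomputable def limitLaw : Measure ℂ :=
  (stdGaussian ℂ).map ((√2)⁻¹ • ContinuousLinearMap.id ℝ ℂ)

instance : IsGaussian limitLaw := by
  unfold limitLaw; infer_instance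

lemma charFun_limitLaw (t : ℂ) : charFun limitLaw t = (Real.exp (-(‖t‖ ^ 2 / 4)) : ℝ) := by
  have h : limitLaw = (stdGaussian ℂ).map ((√2)⁻¹ • ·) := rfl
  rw [h, charFun_map_smul, charFun_stdGaussian, norm_smul, norm_inv, Real.norm_eq_abs,
    abs_of_nonneg (Real.sqrt_nonneg 2), Complex.ofReal_exp]
  congr 1
  rw [← Complex.ofReal_pow, mul_pow, inv_pow, Real.sq_sqrt zero_le_two]
  push_cast
  ring

lemma variance_limitLaw (L : StrongDual ℝ ℂ) (hL : L ≠ 0) : 0 < Var[L; limitLaw] := by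
  rw [limitLaw, variance_map (by fun_prop) (by fun_prop)]
  have h : L ∘ ((√2)⁻¹ • ContinuousLinearMap.id ℝ ℂ) = ((√2)⁻¹ • L : StrongDual ℝ ℂ) := by
    ext x
    exact L.map_smul _ x
  rw [h, variance_dual_stdGaussian]
  have : (√2)⁻¹ • L ≠ 0 := smul_ne_zero (by simp) hL
  positivity

namespace IsNoise

variable {Ω : Type*} {N : (s : Source) → Ω → s.Val} {n : ℕ}
  [mΩ : MeasurableSpace Ω] {p : ℝ} {μ : Measure Ω}
  (hN : IsNoise p N μ)
include hN

lemma measurable_S (n : ℕ) : Measurable (S N n) :=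
  Finset.measurable_fun_sum _ fun i _ => hN.measurable_X i

variable [IsProbabilityMeasure μ]

lemma tendsto_integral_exp_stepSum (hp0 : 0 ≤ p) (hp1 : p < 1) (t : ℂ) :
    Tendsto (fun n : ℕ => ∫ a, Complex.exp
      (stepSum N (fun v => inner ℝ v t / √n) n a * Complex.I) ∂μ) atTop
      (𝓝 (Real.exp (-(‖t‖ ^ 2 / 4)) : ℝ)) := by
  set θ : ℕ → ℂ → ℝ := fun n v => inner ℝ v t / √n with hθ
  have hθm (n : ℕ) : Measurable (θ n) := by
    have : Continuous (θ n) := by simp only [hθ]; fun_prop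
    exact this.measurable
  have hmean : Tendsto (fun n : ℕ => n * stepMean fun v => -Real.log (Real.cos (θ n v))) atTop
      (𝓝 (‖t‖ ^ 2 / 4)) := by
    rw [← stepMean_inner_sq t]
    simp_rw [stepMean, mul_div_assoc', Finset.mul_sum]
    exact (tendsto_finsetSum _ fun v _ => tendsto_mul_neg_log_cos _).div_const 6
  have hmain : Tendsto (fun n : ℕ =>
      ((Real.exp (-(n * stepMean fun v => -Real.log (Real.cos (θ n v)))) : ℝ) : ℂ)) atTop
      (𝓝 (Real.exp (-(‖t‖ ^ 2 / 4)) : ℝ)) :=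
    (Complex.continuous_ofReal.tendsto _).comp ((Real.continuous_exp.tendsto _).comp hmean.neg)
  -- The comparison is used with `M = ‖t‖ ^ 2 / n`: then `exp (n * M)` does not depend on `n`, while
  -- `M ^ 2 * n ^ (1 + p)` decays like `n ^ (-(1 - p))`.
  have hbound : ∀ᶠ n : ℕ in atTop,
      ‖∫ a, Complex.exp (stepSum N (θ n) n a * Complex.I) ∂μ
        - (Real.exp (-(n * stepMean fun v => -Real.log (Real.cos (θ n v)))) : ℝ)‖
      ≤ Real.exp (‖t‖ ^ 2) * √((‖t‖ ^ 2) ^ 2 / (1 - p) * (n : ℝ) ^ (-(1 - p))) := by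
    filter_upwards [eventually_gt_atTop 0,
      tendsto_natCast_atTop_atTop.eventually_ge_atTop (‖t‖ ^ 2)] with n hn ht
    have hn' : (0 : ℝ) < n := by exact_mod_cast hn
    have hle : ‖t‖ ^ 2 / n ≤ 1 := (div_le_one hn').2 ht
    have hsq : ∀ v ∈ steps, θ n v ^ 2 ≤ ‖t‖ ^ 2 / n := fun v hv => by
      simp only [hθ, div_pow, Real.sq_sqrt hn'.le]
      refine div_le_div_of_nonneg_right ?_ hn'.le
      have h := abs_real_inner_le_norm v t
      rw [norm_eq_one_of_mem_steps hv, one_mul] at h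
      exact sq_le_sq' (neg_le_of_abs_le h) (le_of_abs_le h)
    refine (hN.norm_integral_exp_stepSum_sub_le hp0 hp1 (hθm n)
      (fun v => by simp only [hθ, inner_neg_left, neg_div]) (M := ‖t‖ ^ 2 / n)
      (fun v hv => by linarith [half_le_cos ((hsq v hv).trans hle)])
      (fun v hv => (neg_log_cos_le_sq ((hsq v hv).trans hle)).trans (hsq v hv)) n).trans
      (le_of_eq ?_)
    have hpow : (n : ℝ) ^ (1 + p) = (n : ℝ) ^ (-(1 - p)) * (n : ℝ) ^ 2 := by
      rw [← Real.rpow_natCast, ← Real.rpow_add hn']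
      congr 1
      push_cast
      ring
    rw [mul_div_cancel₀ _ hn'.ne', hpow]
    congr 2
    field_simp
  have hzero : Tendsto (fun n : ℕ => Real.exp (‖t‖ ^ 2)
      * √((‖t‖ ^ 2) ^ 2 / (1 - p) * (n : ℝ) ^ (-(1 - p)))) atTop (𝓝 0) := by
    have h := (((tendsto_rpow_neg_atTop (sub_pos.2 hp1)).comp
      (tendsto_natCast_atTop_atTop (R := ℝ))).const_mul ((‖t‖ ^ 2) ^ 2 / (1 - p))).sqrt.const_mul
      (Real.exp (‖t‖ ^ 2))
    simpa using h
  have h := (squeeze_zero_norm' hbound hzero).add hmain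
  simp only [sub_add_cancel, zero_add] at h
  exact h

theorem tendstoInDistribution_S_div_sqrt (hp0 : 0 ≤ p) (hp1 : p < 1) :
    TendstoInDistribution (fun (n : ℕ) (a : Ω) => S N n a / (√n : ℂ)) atTop
      (fun y : ℂ => y) (fun _ => μ) limitLaw where
  forall_aemeasurable n := ((hN.measurable_S n).div_const _).aemeasurable
  aemeasurable_limit := measurable_id.aemeasurable
  tendsto := by
    refine ProbabilityMeasure.tendsto_iff_tendsto_charFun.2 fun t => ?_
    change Tendsto (fun n : ℕ => charFun (μ.map fun a => S N n a / (√n : ℂ)) t) atTop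
      (𝓝 (charFun (limitLaw.map fun y => y) t))
    rw [Measure.map_id', charFun_limitLaw]
    refine (hN.tendsto_integral_exp_stepSum hp0 hp1 t).congr fun n => ?_
    rw [charFun_apply, integral_map ((hN.measurable_S n).div_const _).aemeasurable
      (by fun_prop)]
    refine integral_congr_ae (.of_forall fun a => ?_)
    simp only [stepSum, S]
    rw [div_eq_inv_mul (∑ i ∈ Finset.range n, X N i a), ← Complex.ofReal_inv,
      ← Complex.real_smul (x := (√n)⁻¹), real_inner_smul_left, sum_inner, Finset.mul_sum]
    simp_rw [div_eq_inv_mul]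

end IsNoise

end ElephantWalk

theorem mainTheorem1 :
    ∃ (ν : Measure ℂ) (_ : IsGaussian ν),
      (∀ L : StrongDual ℝ ℂ, L ≠ 0 → 0 < Var[L; ν]) ∧
      ∀ (p : ℝ), 0 ≤ p → p ≤ 1 →
      ∀ (Ω : Type*) [MeasurableSpace Ω] (μ : Measure Ω) [IsProbabilityMeasure μ]
        (N : (s : ElephantWalk.Source) → Ω → s.Val), ElephantWalk.IsNoise p N μ →
        (∀ᵐ a ∂μ, Tendsto (fun n : ℕ => ElephantWalk.S N n a / (n : ℂ)) atTop (𝓝 0)) ∧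
        (p < 1 →
          TendstoInDistribution
            (fun (n : ℕ) (a : Ω) => ElephantWalk.S N n a / (Real.sqrt n : ℂ)) atTop
            (fun y : ℂ => y) (fun _ => μ) ν) :=
  ⟨ElephantWalk.limitLaw, inferInstance, ElephantWalk.variance_limitLaw,
    fun _ hp0 hp1 _ _ _ _ _ hN => ⟨hN.ae_tendsto_S_div hp0 hp1,
      fun hp => hN.tendstoInDistribution_S_div_sqrt hp0 hp⟩⟩
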